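/- **Setting.** There are finitely many agents $\mathcal A=\{1,\dots,n\}$ and discrete time $\mathbb T=\mathbb N$. *Haps* are actions or events. Actions of agent $i$ in local format are sends $\mathit{send}(j,\mu_k)$ (copy $k$ of message $\mu$ to agent $j$) and internal actions. A local action $a$ of $i$ initiated at time $t$ has a global format $\mathit{global}(i,t,a)$, where $\mathit{global}$ is one-to-one; a send gets the global form $\mathit{gsend}(i,j,\mu,id)$ with identifier $id=id(i,j,\mu,k,t)$ given by a one-to-one function. *Correct events* $O$ of agent $j$ are in global format, among them deliveries $\mathit{grecv}(j,i,\mu,id)$ to $j$ of $\mu$ sent by $i$, and $\mathit{local}(O)$ is the way in which $O$ is recorded by the agent, with $\mathit{local}(\mathit{grecv}(j,i,\mu,id))=\mathit{recv}(i,\mu)$. *Byzantine events* of $i$ are $\mathit{fake}(i,E)$ ($i$ perceives the correct event $E$ of its own, which did not happen) and $\mathit{fake}(i,A\mapsto A')$ ($i$ performs $A$ but perceives $A'$, each a global action of $i$ or $\mathbf{noop}$). System events are $go(i)$, $sleep(i)$, $hibernate(i)$. The *faulty* events of $i$ are its byzantine events, $sleep(i)$ and $hibernate(i)$. A set $X$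 of events is *$t$-coherent* if it contains at most one system event per agent, contains no correct event of $i$ together with some $\mathit{fake}(i,E)$ that $i$ records in the same way, and every byzantine send in it carries an identifier of the form $id(i,j,\mu,k,t)$. An *agent-context* $\chi$ consists of a number $f\ge 0$, an environment protocol $P_\epsilon$ assigning to each $t$ a non-empty collection of $t$-coherent sets of events, protocols $P_i$ assigning to each local state of $i$ a non-empty collection of sets of $i$'s local actions, a set of global initial states, and a set $\Psi$ of admissible runs. A *run* $r$ is a sequence of global states $r(t)=(r_\epsilon(t),r_1(t),\dots,r_n(t))$. It is *weakly $\chi$-consistent* if it starts in an initial state (with empty environment history) and each round, from $t$ to $t+1$, proceeds as follows. Some $X\in P_\epsilon(t)$ and $X_i\in P_i(r_i(t))$ are chosen, and the $X_i$ are translated into global format with time $t$. If $X$ would bring the number of agents that have had a faulty event above $f$, then all faulty events are removed from $X$. Then deliveries of messages not sent (correctly or by a byzantine send) in the past or in this round are removed; here a correct attempted send of this round counts only if $go$ of its sender is present. The result is the set $\beta^t_\epsilon(r)$ of events that happen, and the set $\beta^t_i(r)$ of performed actions is the translated $X_i$ if $go(i)\in\beta^t_\epsilon(r)$ and $\varnothing$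 otherwise. All these haps are recorded in $r_\epsilon$. The set of all haps of $i$ perceived in this round, in local format, is appended to the list $r_i(t)$; $r_i$ remains unchanged if $i$ perceives nothing from its events and neither $go(i)$ nor $sleep(i)$ happens. $R^\chi$ is the set of weakly $\chi$-consistent runs in $\Psi$. $\chi$ is *non-excluding* if each finite prefix of a weakly $\chi$-consistent run extends to a run in $R^\chi$. Agent $i$ is *correctable* (*delayable*) if, for every $t$ and every $X\in P_\epsilon(t)$, removing all faulty events (all events) of $i$ from $X$ gives a set in $P_\epsilon(t)$; it is *gullible* if for $X\in P_\epsilon(t)$, replacing all events of $i$ in $X$ by an arbitrary set $Y$ of faulty events of $i$ gives a set in $P_\epsilon(t)$ whenever the result is $t$-coherent. A node $(j,m)\in\mathcal A\times\mathbb T$ is *correct in $r$* if no faulty event of $j$ is recorded in $r_\epsilon(m)$. *Causal $r$-links* are $(j,m)\to(j,m+1)$ and $(k,m)\to(j,l)$, $l\ge1$, whenever $\mathit{grecv}(j,k,\mu,id)\in\beta^{l-1}_\epsilon(r)$ for some $\mu,id$ such that the matching send is in $\beta^m_k(r)$ or is performed by a byzantine event in $\beta_\epsilon^m(r)$. A *causal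 $r$-path* is a finite sequence $\theta_0,\dots,\theta_k$ ($k\ge0$) of nodes joined by causal $r$-links; it is *reliable* if $(j_l,t_l+1)$ is correct for each $\theta_l=(j_l,t_l)$, $l<k$, and $\theta_k$ is correct. The *reliable causal cone* of $\theta$ in $r$ is the set of nodes with a reliable causal $r$-path to $\theta$. The *fault buffer* of $\theta=(i,t)$ in $r$ is the set of nodes $(j,m)$ with $m<t$ that have a causal $r$-path to $\theta$ and for which $(j,m+1)$ is not correct in $r$; $\mathit{Byz}^r_\theta$ is the set of agents $j$ with some node $(j,m)$ in the fault buffer. In an interpreted system $\mathcal I=(R^\chi,\pi)$, the formula $\mathit{correct}_i$ holds at $(r,t)$ iff $(i,t)$ is correct in $r$; $\overline{\mathit{occurred}}(o)$ holds at $(r,t)$ iff some correct event $O$ with $\mathit{local}(O)=o$ happens in one of the first $t$ rounds; $K_i\varphi$ holds at $(r,t)$ iff $\varphi$ holds at all $(r',t')$ with $r'\in R^\chi$, $t'\in\mathbb T$ and $r'_i(t')=r_i(t)$; and $H_i\varphi:=\mathit{correct}_i\to K_i(\mathit{correct}_i\to\varphi)$ (hope). The run $r$ *contains a multipede* for $o$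 at $\theta=(i,t)$ if for every $\hat r\in R^\chi$ with $\hat r_i(t)=r_i(t)$ in which $\theta$ is correct, there are a node $(j,m)$ in the reliable causal cone of $\theta$ in $\hat r$ and a correct event $O\in\beta^m_\epsilon(\hat r)$ of $j$ with $\mathit{local}(O)=o$. **Theorem.** Let $\chi$ be a non-excluding agent-context in which all agents are gullible, correctable and delayable, $\mathcal I=(R^\chi,\pi)$ an interpreted system, $r\in R^\chi$, $\theta=(i,t)$ a node correct in $r$, and $o$ an event in local format. Suppose that $(\mathcal I,r,t)\models H_i\,\overline{\mathit{occurred}}(o)$, or that $r$ contains a multipede for $o$ at $\theta$. Then for every $S\subseteq\mathcal A\setminus(\{i\}\cup\mathit{Byz}^r_\theta)$ with $|S|=f-|\mathit{Byz}^r_\theta|$ there are an agent $w_S$, a time $m_S$ and a correct event $O_S\in\beta^{m_S}_\epsilon(r)$ of $w_S$ with $\mathit{local}(O_S)=o$, and there is a causal $r$-path from $(w_S,m_S)$ to $\theta$ none of whose nodes belongs to an agent in $S\cup\mathit{Byz}^r_\theta$. -/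

import Mathlib

namespace ByzCausal

/-! ### Haps in local and global format -/

/-- Events in the local format: `recv j μ` records the receipt of message `μ` from agent `j`, and
`ext e` is any other local event. -/
inductive LocalEvent (Agent Msg Ext : Type*) where
  | recv (j : Agent) (μ : Msg)
  | ext (e : Ext)

/-- The static data of a multi-agent system: the finite set `Fin n` of agents, the messages, the
possible initial local states of the agents, the agents' non-send actions, the non-receive events
in local format and, for each agent, the correct non-receive events in global format together with
the way in which they are recorded locally, and the one-to-one function that assigns to the sending
(by `i` to `j`, of copy number `k` of `μ`, at time `t`) its global message identifier. -/
structure Signature where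
  n : ℕ
  Msg : Type*
  Init : Fin n → Type*
  IntAct : Fin n → Type*
  Ext : Type*
  GExt : Fin n → Type*
  extLocal : (i : Fin n) → GExt i → LocalEvent (Fin n) Msg Ext
  gmi : Fin n × Fin n × Msg × ℕ × ℕ → ℕ
  gmi_injective : Function.Injective gmi

/-- The agents. -/
abbrev Signature.Agent (S : Signature) : Type := Fin S.n

/-- Local events; which of them agent `i` can witness is given by `Signature.eventsOf`. -/
abbrev Signature.LEvent (S : Signature) := LocalEvent S.Agent S.Msg S.Ext

/-- The set of actions of agent `i` in local format. `send j μ k` is the sending of copy number `k`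
of message `μ` to agent `j`. -/
inductive LAction (S : Signature) (i : S.Agent) where
  | send (j : S.Agent) (μ : S.Msg) (k : ℕ)
  | int (a : S.IntAct i)

/-- Haps (actions or events) of agent `i` in local format. -/
abbrev LHap (S : Signature) (i : S.Agent) := S.LEvent ⊕ LAction S i

/-- Correct actions of agent `i` in global format: `⟨t, a⟩` is the global format of the
local action `a` when initiated at time `t`. -/
structure GAction (S : Signature) (i : S.Agent) where
  time : ℕ
  act : LAction S i

/-- `A.IsSend j μ d`: the global action `A` of `i` is the sending to `j` of the message `μ` with
global message identifier `d`. -/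
def GAction.IsSend {S : Signature} {i : S.Agent} (A : GAction S i) (j : S.Agent) (μ : S.Msg)
    (d : ℕ) : Prop :=
  ∃ k, A.act = .send j μ k ∧ S.gmi (i, j, μ, k, A.time) = d

/-- Correct events of agent `i` in global format. `grecv j μ d` is the delivery to `i` of the
message `μ` with global message identifier `d` sent by agent `j`. -/
inductive CEvent (S : Signature) (i : S.Agent) where
  | grecv (j : S.Agent) (μ : S.Msg) (d : ℕ)
  | ext (E : S.GExt i)

/-- The local format of a correct event. -/
def CEvent.toLocal {S : Signature} {i : S.Agent} : CEvent S i → S.LEvent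
  | .grecv j μ _ => .recv j μ
  | .ext E => S.extLocal i E

/-- The events that agent `i` can witness, in local format. -/
def Signature.eventsOf (S : Signature) (i : S.Agent) : Set S.LEvent :=
  Set.range (CEvent.toLocal (S := S) (i := i))

/-- The events that some agent can witness, in local format. -/
def Signature.events (S : Signature) : Set S.LEvent := ⋃ i, S.eventsOf i

/-- All events in global format: the correct events, their byzantine counterparts, the byzantine
actions and the system events. In `fakeAct i A A'`, agent `i` performs `A` while it perceives `A'`;
`none` stands for inaction, so that `fakeAct i none none` makes `i` faulty without any other
effect. -/
inductive GEvent (S : Signature) where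
  | correct (i : S.Agent) (E : CEvent S i)
  | fakeEv (i : S.Agent) (E : CEvent S i)
  | fakeAct (i : S.Agent) (A A' : Option (GAction S i))
  | go (i : S.Agent)
  | sleep (i : S.Agent)
  | hibernate (i : S.Agent)

/-- The agent to which a global event pertains. -/
def GEvent.agent {S : Signature} : GEvent S → S.Agent
  | .correct i _ => i
  | .fakeEv i _ => i
  | .fakeAct i _ _ => i
  | .go i => i
  | .sleep i => i
  | .hibernate i => i

/-- Byzantine events, and the system events that signify a failure to activate the protocol. -/
def GEvent.IsFaulty {S : Signature} : GEvent S → Prop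
  | .correct _ _ => False
  | .fakeEv _ _ => True
  | .fakeAct _ _ _ => True
  | .go _ => False
  | .sleep _ => True
  | .hibernate _ => True

/-- All global events of agent `i`. -/
def gEvents (S : Signature) (i : S.Agent) : Set (GEvent S) := {e | e.agent = i}

/-- All faulty global events of agent `i` (byzantine ones, `sleep i` and `hibernate i`). -/
def fEvents (S : Signature) (i : S.Agent) : Set (GEvent S) := {e | e.agent = i ∧ e.IsFaulty}

/-- All haps in global format. -/
abbrev GHap (S : Signature) := GEvent S ⊕ (Σ i : S.Agent, GAction S i)

/-! ### States and runs -/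

/-- Local states: an initial local state followed by the list (latest first) of the sets of haps
perceived in the rounds in which the agent was active. -/
structure LState (S : Signature) (i : S.Agent) where
  init : S.Init i
  hist : List (Set (LHap S i))

/-- Global states: the environment's record (latest round first) of all haps in global format, and
the local states of all agents. -/
structure GState (S : Signature) where
  env : List (Set (GHap S))
  loc : (i : S.Agent) → LState S i

/-- Runs. -/
abbrev Run (S : Signature) := ℕ → GState S

/-- The global hap `O` is recorded in the environment's history of `h`. -/
def GState.Has {S : Signature} (h : GState S) (O : GHap S) : Prop := ∃ X ∈ h.env, O ∈ X

/-- Agent `i` has already exhibited faulty behaviour in the global state `h`. -/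
def GState.Failed {S : Signature} (h : GState S) (i : S.Agent) : Prop :=
  ∃ e ∈ fEvents S i, h.Has (.inl e)

/-- The events that happen in the round between `t` and `t + 1` of the run `r`. -/
def betaEnv {S : Signature} (r : Run S) (t : ℕ) : Set (GEvent S) :=
  {e | Sum.inl e ∈ (r (t + 1)).env.headD ∅}

/-- The correct actions that agent `i` performs in the round between `t` and `t + 1` of `r`. -/
def betaAg {S : Signature} (r : Run S) (t : ℕ) (i : S.Agent) : Set (GAction S i) :=
  {A | Sum.inr ⟨i, A⟩ ∈ (r (t + 1)).env.headD ∅}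

/-! ### Filtering -/

/-- The agents with a faulty event in `X`. -/
def faultyIn {S : Signature} (X : Set (GEvent S)) : Set S.Agent := {i | (X ∩ fEvents S i).Nonempty}

open Classical in
/-- First filter: all faulty events are removed if they would make more than `f` agents faulty. -/
noncomputable def filterLe {S : Signature} (f : ℕ) (h : GState S) (X : Set (GEvent S)) :
    Set (GEvent S) :=
  if ({i | h.Failed i} ∪ faultyIn X).ncard ≤ f then X else X \ ⋃ i, fEvents S i

/-- In the state `h` with attempted events `X` and attempted actions `α`, there is a (correct or
byzantine) sending by `i` to `j` of `μ` with identifier `d`, in the past or in this round. -/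
def HasSend {S : Signature} (h : GState S) (X : Set (GEvent S))
    (α : (i : S.Agent) → Set (GAction S i)) (i j : S.Agent) (μ : S.Msg) (d : ℕ) : Prop :=
  ∃ A : GAction S i, A.IsSend j μ d ∧
    (h.Has (.inr ⟨i, A⟩) ∨ (∃ A', h.Has (.inl (.fakeAct i (some A) A'))) ∨
      (A ∈ α i ∧ .go i ∈ X) ∨ ∃ A', .fakeAct i (some A) A' ∈ X)

/-- Second filter: correct receives without a matching send are removed. -/
def filterB {S : Signature} (h : GState S) (X : Set (GEvent S))
    (α : (i : S.Agent) → Set (GAction S i)) : Set (GEvent S) :=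
  X \ {e | ∃ j i μ d, e = .correct j (.grecv i μ d) ∧ ¬ HasSend h X α i j μ d}

/-- The filter for events. -/
noncomputable def filterEnv {S : Signature} (f : ℕ) (h : GState S) (X : Set (GEvent S))
    (α : (i : S.Agent) → Set (GAction S i)) : Set (GEvent S) :=
  filterB h (filterLe f h X) α

/-- The filter for actions: `i` acts only if woken up by `go i`. -/
def filterAg {S : Signature} (X : Set (GEvent S)) (α : (i : S.Agent) → Set (GAction S i))
    (i : S.Agent) : Set (GAction S i) :=
  {A | A ∈ α i ∧ .go i ∈ X}

/-! ### Updating -/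

/-- The haps perceived by `i`, in local format, when the events `X` and `i`'s actions `Y` happen. -/
def perceived {S : Signature} (i : S.Agent) (X : Set (GEvent S)) (Y : Set (GAction S i)) :
    Set (LHap S i) :=
  {o | (∃ E, (.correct i E ∈ X ∨ .fakeEv i E ∈ X) ∧ o = .inl E.toLocal) ∨
    ∃ A : GAction S i, (A ∈ Y ∨ ∃ A', .fakeAct i A' (some A) ∈ X) ∧ o = .inr A.act}

open Classical in
/-- The update function for the local state of `i`. -/
noncomputable def updateAg {S : Signature} (i : S.Agent) (s : LState S i) (Y : Set (GAction S i))
    (X : Set (GEvent S)) : LState S i :=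
  if perceived i X ∅ = ∅ ∧ .go i ∉ X ∧ .sleep i ∉ X then s
  else ⟨s.init, perceived i X Y :: s.hist⟩

/-- All haps of a round with events `X` and actions `Y`. -/
def roundHaps {S : Signature} (X : Set (GEvent S)) (Y : (i : S.Agent) → Set (GAction S i)) :
    Set (GHap S) :=
  {O | (∃ e ∈ X, O = .inl e) ∨ ∃ i, ∃ A ∈ Y i, O = .inr ⟨i, A⟩}

/-- The global update function. -/
noncomputable def update {S : Signature} (h : GState S) (X : Set (GEvent S))
    (Y : (i : S.Agent) → Set (GAction S i)) : GState S :=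
  ⟨roundHaps X Y :: h.env, fun i => updateAg i (h.loc i) (Y i) X⟩

/-! ### Protocols, contexts, consistent runs -/

/-- Mutual compatibility at time `t` of a set of events: at most one system event per agent; no
correct event comes with a byzantine event that its agent perceives in the same way; byzantine sends
have the message identifier of a send in this round. -/
structure Coherent {S : Signature} (t : ℕ) (X : Set (GEvent S)) : Prop where
  system : ∀ i, (X ∩ {.go i, .sleep i, .hibernate i}).Subsingleton
  perception : ∀ i (E E' : CEvent S i), .correct i E ∈ X → .fakeEv i E' ∈ X →
    E.toLocal ≠ E'.toLocal
  identifier : ∀ i (A : GAction S i) A' j μ d, .fakeAct i (some A) A' ∈ X → A.IsSend j μ d →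
    ∃ k, d = S.gmi (i, j, μ, k, t)

/-- Agent-contexts for asynchronous agents, at most `f` of which are byzantine: the environment's
protocol, the agents' joint protocol, the global initial states, and the admissibility condition. -/
structure AgentContext (S : Signature) where
  f : ℕ
  envP : ℕ → Set (Set (GEvent S))
  envP_nonempty : ∀ t, (envP t).Nonempty
  envP_coherent : ∀ t, ∀ X ∈ envP t, Coherent t X
  agP : (i : S.Agent) → LState S i → Set (Set (LAction S i))
  agP_nonempty : ∀ i s, (agP i s).Nonempty
  init : Set ((i : S.Agent) → S.Init i)
  adm : Set (Run S)

/-- The actions of `i` chosen in local format, labelled with the time `t`. -/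
def label {S : Signature} (t : ℕ) {i : S.Agent} (X : Set (LAction S i)) : Set (GAction S i) :=
  {A | ∃ a ∈ X, A = ⟨t, a⟩}

/-- The transition relation for the round between `t` and `t + 1`. -/
def Transition {S : Signature} (χ : AgentContext S) (t : ℕ) (h h' : GState S) : Prop :=
  ∃ X ∈ χ.envP t, ∃ α : (i : S.Agent) → Set (LAction S i),
    (∀ i, α i ∈ χ.agP i (h.loc i)) ∧
      h' = update h (filterEnv χ.f h X fun i => label t (α i))
        (filterAg (filterEnv χ.f h X fun i => label t (α i)) fun i => label t (α i))

/-- `h` is a global initial state: nothing has happened yet, and the local states form one of the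
allowed tuples of initial local states. -/
def IsInitial {S : Signature} (χ : AgentContext S) (h : GState S) : Prop :=
  h.env = [] ∧ ∃ s ∈ χ.init, ∀ i, h.loc i = ⟨s i, []⟩

/-- Weakly consistent runs: transitional runs that start in an initial state. -/
def WeaklyConsistent {S : Signature} (χ : AgentContext S) (r : Run S) : Prop :=
  IsInitial χ (r 0) ∧ ∀ t, Transition χ t (r t) (r (t + 1))

/-- The set of consistent runs. -/
def runs {S : Signature} (χ : AgentContext S) : Set (Run S) :=
  {r | WeaklyConsistent χ r ∧ r ∈ χ.adm}

/-- Any finite prefix of a weakly consistent run extends to a consistent run. -/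
def NonExcluding {S : Signature} (χ : AgentContext S) : Prop :=
  ∀ r, WeaklyConsistent χ r → ∀ t, ∃ r' ∈ runs χ, ∀ m ≤ t, r' m = r m

/-- `i`'s faults can always be removed. -/
def Correctable {S : Signature} (χ : AgentContext S) (i : S.Agent) : Prop :=
  ∀ t, ∀ X ∈ χ.envP t, X \ fEvents S i ∈ χ.envP t

/-- `i` can always be made to skip a round. -/
def Delayable {S : Signature} (χ : AgentContext S) (i : S.Agent) : Prop :=
  ∀ t, ∀ X ∈ χ.envP t, X \ gEvents S i ∈ χ.envP t

/-- `i`'s events can always be replaced by arbitrary faults. -/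
def Gullible {S : Signature} (χ : AgentContext S) (i : S.Agent) : Prop :=
  ∀ t, ∀ X ∈ χ.envP t, ∀ Y ⊆ fEvents S i, Coherent t (Y ∪ (X \ gEvents S i)) →
    Y ∪ (X \ gEvents S i) ∈ χ.envP t

/-! ### Causality -/

/-- Agent-time nodes. -/
abbrev Node (S : Signature) := S.Agent × ℕ

/-- The node `θ = (i, t)` is correct in `r`: no fault happened to `i` by time `t`. -/
def NodeCorrect {S : Signature} (r : Run S) (θ : Node S) : Prop := ¬ (r θ.2).Failed θ.1

/-- Links by messages: a message sent by `i` (correctly or not) in the round after `m` is correctly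
received by `j` in the round before `l`. -/
def MsgLink {S : Signature} (r : Run S) (a b : Node S) : Prop :=
  ∃ l, b.2 = l + 1 ∧ ∃ μ d, .correct b.1 (.grecv a.1 μ d) ∈ betaEnv r l ∧
    ∃ A : GAction S a.1, A.IsSend b.1 μ d ∧
      (A ∈ betaAg r a.2 a.1 ∨ ∃ A', .fakeAct a.1 (some A) A' ∈ betaEnv r a.2)

/-- Causal links: local ones and those by messages. -/
def CausalLink {S : Signature} (r : Run S) (a b : Node S) : Prop :=
  b = (a.1, a.2 + 1) ∨ MsgLink r a b

/-- `ξ 0, …, ξ k` is a causal path in `r` from `a` to `b`. -/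
def IsCausalPath {S : Signature} (r : Run S) (k : ℕ) (ξ : ℕ → Node S) (a b : Node S) : Prop :=
  ξ 0 = a ∧ ξ k = b ∧ ∀ l < k, CausalLink r (ξ l) (ξ (l + 1))

/-- The causal path `ξ 0, …, ξ k` is reliable. -/
def IsReliable {S : Signature} (r : Run S) (k : ℕ) (ξ : ℕ → Node S) : Prop :=
  (∀ l < k, NodeCorrect r ((ξ l).1, (ξ l).2 + 1)) ∧ NodeCorrect r (ξ k)

/-- The reliable causal cone of `θ` in `r`. -/
def reliableCone {S : Signature} (r : Run S) (θ : Node S) : Set (Node S) :=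
  {ζ | ∃ k ξ, IsCausalPath r k ξ ζ θ ∧ IsReliable r k ξ}

/-- The fault buffer of `θ` in `r`. -/
def faultBuffer {S : Signature} (r : Run S) (θ : Node S) : Set (Node S) :=
  {ζ | ζ.2 < θ.2 ∧ (∃ k ξ, IsCausalPath r k ξ ζ θ) ∧ ¬ NodeCorrect r (ζ.1, ζ.2 + 1)}

/-- The agents with a node in the fault buffer of `θ` in `r`. -/
def byz {S : Signature} (r : Run S) (θ : Node S) : Set S.Agent :=
  {j | ∃ m, (j, m) ∈ faultBuffer r θ}

/-- Some correct event that is recorded locally as `o` happens to agent `j` in the round after the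
node `(j, m)`. -/
def CorrectlyOccursAt {S : Signature} (r : Run S) (o : S.LEvent) (j : S.Agent) (m : ℕ) : Prop :=
  ∃ O : CEvent S j, .correct j O ∈ betaEnv r m ∧ O.toLocal = o

/-! ### Epistemic language -/

/-- Epistemic formulas over the atoms `Atom`, with designated atoms for the correctness of an agent
and for the correct occurrence of an event. -/
inductive Formula (S : Signature) (Atom : Type*) where
  | atom (p : Atom)
  | correct (i : S.Agent)
  | trueOcc (o : S.LEvent)
  | neg (φ : Formula S Atom)
  | and (φ ψ : Formula S Atom)
  | know (i : S.Agent) (φ : Formula S Atom)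

/-- Implication. -/
def Formula.imp {S : Signature} {Atom : Type*} (φ ψ : Formula S Atom) : Formula S Atom :=
  .neg (.and φ (.neg ψ))

/-- The hope modality. -/
def Formula.hope {S : Signature} {Atom : Type*} (i : S.Agent) (φ : Formula S Atom) :
    Formula S Atom :=
  .imp (.correct i) (.know i (.imp (.correct i) φ))

/-- Truth at time `t` of the run `r` in the interpreted system given by the consistent runs and the
valuation `π` of the atoms that are not designated. -/
def Sat {S : Signature} {Atom : Type*} (χ : AgentContext S) (π : Atom → Set (runs χ × ℕ)) :
    Formula S Atom → runs χ → ℕ → Prop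
  | .atom p, r, t => (r, t) ∈ π p
  | .correct i, r, t => NodeCorrect r.1 (i, t)
  | .trueOcc o, r, t => ∃ j, ∃ m, 1 ≤ m ∧ m ≤ t ∧ CorrectlyOccursAt r.1 o j (m - 1)
  | .neg φ, r, t => ¬ Sat χ π φ r t
  | .and φ ψ, r, t => Sat χ π φ r t ∧ Sat χ π ψ r t
  | .know i φ, r, t => ∀ (r' : runs χ) (t' : ℕ), (r.1 t).loc i = (r'.1 t').loc i → Sat χ π φ r' t'

/-- The run `r` contains a multipede for `o` at `θ = (i, t)`: in every consistent run that agent `i`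
cannot tell from `r` at time `t` and in which `θ` is correct, `o` happens correctly inside the
reliable causal cone of `θ`. -/
def ContainsMultipede {S : Signature} (χ : AgentContext S) (r : Run S) (o : S.LEvent)
    (θ : Node S) : Prop :=
  ∀ r' ∈ runs χ, (r θ.2).loc θ.1 = (r' θ.2).loc θ.1 → NodeCorrect r' θ →
    ∃ j m, (j, m) ∈ reliableCone r' θ ∧ CorrectlyOccursAt r' o j m

end ByzCausal

namespace ByzCausal

variable {S : Signature}

/-! The argument is a "brain in a vat" construction. Let `B` be the union of `T` and the byzantine
agents of the fault buffer; the cardinality hypothesis gives `|B| ≤ f`. From `r` one builds a run in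
which the agents of `B` do nothing but repeat, as byzantine actions, whatever they did in `r`. Every
other agent takes part only at nodes before time `t` that have a causal path to `(i, t)` avoiding
`B`, and there only in the non-faulty events attempted in `r`.

Gullibility, correctability and delayability make this environment behaviour admissible
(`vatEvents_mem_envP`), and at most `f` agents ever become faulty, so no fault is filtered out. No
fault happens in `r` at a node of the avoiding cone before time `t`: such a node would be in the
fault buffer and its agent in `B`. A message received on the way into a cone node comes either from
`B`, where it is replayed, or from another cone node. By induction on time, the two runs give the
same local states throughout the cone (`vat_loc_eq`).

So `i` is correct in the new run and cannot tell it from `r`; hope, or the multipede, forces `o` to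
occur correctly there. Correct events of the new run happen only inside the cone, and they happen in
`r` as well (`correct_mem_of_vat`). Membership in the cone is the required path. -/

/-! ### Runs described by their attempted events and actions -/

/-- The actions that agent `i` performs in the round after `t`, correctly or not. -/
def sent (r : Run S) (t : ℕ) (i : S.Agent) : Set (GAction S i) :=
  {A | A ∈ betaAg r t i ∨ ∃ A', .fakeAct i (some A) A' ∈ betaEnv r t}

/-- In each round `t` of `r`, the events `X t` and the actions `α t` are attempted. -/
structure Executes (χ : AgentContext S) (r : Run S) (X : ℕ → Set (GEvent S))
    (α : ℕ → (i : S.Agent) → Set (LAction S i)) : Prop where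
  initial : IsInitial χ (r 0)
  env_mem : ∀ t, X t ∈ χ.envP t
  act_mem : ∀ t i, α t i ∈ χ.agP i ((r t).loc i)
  step : ∀ t, r (t + 1) = update (r t) (filterEnv χ.f (r t) (X t) fun i => label t (α t i))
    (filterAg (filterEnv χ.f (r t) (X t) fun i => label t (α t i)) fun i => label t (α t i))

theorem WeaklyConsistent.exists_executes {χ : AgentContext S} {r : Run S}
    (h : WeaklyConsistent χ r) : ∃ X α, Executes χ r X α := by
  choose X hX α hα hs using h.2
  exact ⟨X, α, h.1, hX, hα, hs⟩

theorem filterLe_subset (f : ℕ) (h : GState S) (X : Set (GEvent S)) : filterLe f h X ⊆ X := by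
  unfold filterLe
  split_ifs
  · exact subset_rfl
  · exact Set.sdiff_subset

theorem mem_filterLe_of_not_isFaulty {f : ℕ} {h : GState S} {X : Set (GEvent S)} {e : GEvent S}
    (he : ¬ e.IsFaulty) : e ∈ filterLe f h X ↔ e ∈ X := by
  unfold filterLe
  split_ifs
  · rfl
  · simp [fEvents, he]

theorem updateAg_congr {i : S.Agent} (s : LState S i) (Y : Set (GAction S i))
    {X X' : Set (GEvent S)} (h : ∀ e : GEvent S, e.agent = i → (e ∈ X ↔ e ∈ X')) :
    updateAg i s Y X = updateAg i s Y X' := by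
  have hp : ∀ Y, perceived i X Y = perceived i X' Y := fun Y => by
    simp only [perceived, h (.correct i _) rfl, h (.fakeEv i _) rfl, h (.fakeAct i _ _) rfl]
  classical
  unfold updateAg
  exact if_congr (by rw [hp, h (.go i) rfl, h (.sleep i) rfl]) rfl (by rw [hp])

namespace Executes

variable {χ : AgentContext S} {r : Run S} {X : ℕ → Set (GEvent S)}
  {α : ℕ → (i : S.Agent) → Set (LAction S i)}

theorem weaklyConsistent (h : Executes χ r X α) : WeaklyConsistent χ r :=
  ⟨h.initial, fun t => ⟨X t, h.env_mem t, α t, h.act_mem t, h.step t⟩⟩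

theorem betaEnv_eq (h : Executes χ r X α) (t : ℕ) :
    betaEnv r t = filterEnv χ.f (r t) (X t) fun i => label t (α t i) := by
  ext e
  simp [betaEnv, h.step t, update, roundHaps]

theorem mem_betaAg (h : Executes χ r X α) {t : ℕ} {i : S.Agent} {A : GAction S i} :
    A ∈ betaAg r t i ↔ A ∈ label t (α t i) ∧ .go i ∈ betaEnv r t := by
  rw [h.betaEnv_eq]
  simp only [betaAg, h.step t, update, roundHaps, filterAg, List.headD_cons, Set.mem_ofPred_eq,
    reduceCtorEq, and_false, exists_false, false_or, Sum.inr.injEq]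
  constructor
  · rintro ⟨j, B, hB, he⟩
    cases he
    exact hB
  · exact fun hA => ⟨i, A, hA, rfl⟩

theorem has_iff (h : Executes χ r X α) (t : ℕ) (O : GHap S) :
    (r t).Has O ↔ ∃ s < t, O ∈ (r (s + 1)).env.headD ∅ := by
  induction t with
  | zero => simp [GState.Has, h.initial.1]
  | succ t ih =>
    have : (r (t + 1)).Has O ↔ O ∈ (r (t + 1)).env.headD ∅ ∨ (r t).Has O := by
      simp [GState.Has, h.step t, update]
    rw [this, ih]
    simp only [Nat.lt_succ_iff_lt_or_eq]
    grind

theorem has_event_iff (h : Executes χ r X α) {t : ℕ} {e : GEvent S} :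
    (r t).Has (.inl e) ↔ ∃ s < t, e ∈ betaEnv r s := h.has_iff t _

theorem has_action_iff (h : Executes χ r X α) {t : ℕ} {i : S.Agent} {A : GAction S i} :
    (r t).Has (.inr ⟨i, A⟩) ↔ ∃ s < t, A ∈ betaAg r s i := h.has_iff t _

theorem betaEnv_subset_filterLe (h : Executes χ r X α) (t : ℕ) :
    betaEnv r t ⊆ filterLe χ.f (r t) (X t) := by
  rw [h.betaEnv_eq]
  exact Set.sdiff_subset

theorem betaEnv_subset (h : Executes χ r X α) (t : ℕ) : betaEnv r t ⊆ X t :=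
  (h.betaEnv_subset_filterLe t).trans (filterLe_subset _ _ _)

theorem mem_betaEnv_of_forall_ne (h : Executes χ r X α) {t : ℕ} {e : GEvent S}
    (he : ∀ i E, e ≠ .correct i E) : e ∈ betaEnv r t ↔ e ∈ filterLe χ.f (r t) (X t) := by
  rw [h.betaEnv_eq]
  simp only [filterEnv, filterB, Set.mem_sdiff, Set.mem_ofPred_eq, and_iff_left_iff_imp]
  rintro - ⟨j, i, μ, d, rfl, -⟩
  exact he _ _ rfl

theorem go_mem_betaEnv (h : Executes χ r X α) {t : ℕ} {i : S.Agent} :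
    .go i ∈ betaEnv r t ↔ .go i ∈ X t := by
  rw [h.mem_betaEnv_of_forall_ne (by simp), mem_filterLe_of_not_isFaulty (by simp [GEvent.IsFaulty])]

/-- Deliveries depend on `sent` alone, which does not separate correct from byzantine sends. This is
what lets a byzantine agent replay a correct one unnoticed. -/
theorem hasSend_iff (h : Executes χ r X α) {t : ℕ} {i j : S.Agent} {μ : S.Msg} {d : ℕ} :
    HasSend (r t) (filterLe χ.f (r t) (X t)) (fun i => label t (α t i)) i j μ d ↔
      ∃ A : GAction S i, A.IsSend j μ d ∧ ∃ s ≤ t, A ∈ sent r s i := by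
  refine exists_congr fun A => and_congr_right fun _ => ?_
  rw [h.has_action_iff]
  simp only [h.has_event_iff, ← h.mem_betaEnv_of_forall_ne (e := .go i) (by simp),
    ← h.mem_betaEnv_of_forall_ne (e := .fakeAct i _ _) (by simp), ← h.mem_betaAg]
  constructor
  · rintro (⟨s, hs, hA⟩ | ⟨A', s, hs, hA⟩ | hA | hA)
    · exact ⟨s, hs.le, Or.inl hA⟩
    · exact ⟨s, hs.le, Or.inr ⟨A', hA⟩⟩
    · exact ⟨t, le_rfl, Or.inl hA⟩
    · exact ⟨t, le_rfl, Or.inr hA⟩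
  · rintro ⟨s, hs, hA | ⟨A', hA⟩⟩ <;> rcases hs.lt_or_eq with hs | rfl
    · exact Or.inl ⟨s, hs, hA⟩
    · exact Or.inr (Or.inr (Or.inl hA))
    · exact Or.inr (Or.inl ⟨A', s, hs, hA⟩)
    · exact Or.inr (Or.inr (Or.inr ⟨A', hA⟩))

theorem correct_mem_betaEnv (h : Executes χ r X α) {t : ℕ} {j : S.Agent} {E : CEvent S j} :
    .correct j E ∈ betaEnv r t ↔ .correct j E ∈ X t ∧ ∀ i μ d, E = .grecv i μ d →
      ∃ A : GAction S i, A.IsSend j μ d ∧ ∃ s ≤ t, A ∈ sent r s i := by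
  rw [h.betaEnv_eq, filterEnv, filterB, Set.mem_sdiff,
    mem_filterLe_of_not_isFaulty (by simp [GEvent.IsFaulty])]
  refine and_congr_right fun _ => ?_
  simp only [Set.mem_ofPred_eq, not_exists, not_and, not_not, ← h.hasSend_iff]
  constructor
  · rintro hX i μ d rfl
    exact hX j i μ d rfl
  · rintro hX j' i μ d he
    cases he
    exact hX i μ d rfl

theorem identifier_of_mem_sent (h : Executes χ r X α) {t : ℕ} {i : S.Agent} {A : GAction S i}
    (hA : A ∈ sent r t i) {j : S.Agent} {μ : S.Msg} {d : ℕ} (hd : A.IsSend j μ d) :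
    ∃ k, d = S.gmi (i, j, μ, k, t) := by
  rcases hA with hA | ⟨A', hA⟩
  · obtain ⟨⟨a, -, rfl⟩, -⟩ := h.mem_betaAg.1 hA
    obtain ⟨k, -, rfl⟩ := hd
    exact ⟨k, rfl⟩
  · exact (χ.envP_coherent t _ (h.env_mem t)).identifier i A A' j μ d (h.betaEnv_subset t hA) hd

/-- A delivery only guarantees some matching send in the past or the same round, and the send in the
link could be another one. Identifiers encode the time of sending injectively, so both sends happen
at the same time. -/
theorem lt_of_causalLink (h : Executes χ r X α) {a b : Node S} (hl : CausalLink r a b) :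
    a.2 < b.2 := by
  rcases hl with rfl | ⟨l, hb, μ, d, hE, A, hd, hA⟩
  · exact Nat.lt_succ_self _
  · obtain ⟨A', hd', s, hs, hA'⟩ := (h.correct_mem_betaEnv.1 hE).2 _ _ _ rfl
    obtain ⟨k, hk⟩ := h.identifier_of_mem_sent hA hd
    obtain ⟨k', hk'⟩ := h.identifier_of_mem_sent hA' hd'
    have := S.gmi_injective (hk.symm.trans hk')
    simp only [Prod.mk.injEq] at this
    omega

theorem le_of_isCausalPath (h : Executes χ r X α) {k : ℕ} {ξ : ℕ → Node S} {a b : Node S}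
    (hp : IsCausalPath r k ξ a b) : a.2 ≤ b.2 := by
  obtain ⟨rfl, rfl, hl⟩ := hp
  have : ∀ l ≤ k, (ξ 0).2 ≤ (ξ l).2 := by
    intro l
    induction l with
    | zero => simp
    | succ l ih => exact fun hlk => (ih (by omega)).trans (h.lt_of_causalLink (hl l hlk)).le
  exact this k le_rfl

theorem failed_iff (h : Executes χ r X α) {t : ℕ} {i : S.Agent} :
    (r t).Failed i ↔ ∃ s < t, ∃ e ∈ betaEnv r s, e.agent = i ∧ e.IsFaulty := by
  simp only [GState.Failed, h.has_event_iff, fEvents, Set.mem_ofPred_eq]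
  grind

end Executes

/-! ### Running the agents in a different environment -/

/-- There is a run with given attempted events and, as long as the local state of an agent agrees
with that in `r`, the attempted actions of that agent in `r`. -/
theorem exists_executes_of_env {χ : AgentContext S} {r : Run S} {X X' : ℕ → Set (GEvent S)}
    {α : ℕ → (i : S.Agent) → Set (LAction S i)} (h : Executes χ r X α)
    (hX' : ∀ t, X' t ∈ χ.envP t) :
    ∃ r' α', Executes χ r' X' α' ∧ r' 0 = r 0 ∧
      ∀ t i, (r' t).loc i = (r t).loc i → α' t i = α t i := by
  classical
  -- Protocols depend only on the local state, so the choice made in `r` stays legitimate wherever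
  -- the local states agree. Elsewhere any permitted choice will do.
  let pick (t : ℕ) (g : GState S) (i : S.Agent) : Set (LAction S i) :=
    if g.loc i = (r t).loc i then α t i else (χ.agP_nonempty i (g.loc i)).some
  let r' : Run S := fun t => Nat.rec (r 0) (fun t g =>
    update g (filterEnv χ.f g (X' t) fun i => label t (pick t g i))
      (filterAg (filterEnv χ.f g (X' t) fun i => label t (pick t g i))
        fun i => label t (pick t g i))) t
  refine ⟨r', fun t => pick t (r' t), ⟨h.initial, hX', fun t i => ?_, fun t => rfl⟩, rfl,
    fun t i hi => if_pos hi⟩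
  by_cases hi : (r' t).loc i = (r t).loc i
  · simp only [pick, if_pos hi]
    rw [hi]
    exact h.act_mem t i
  · simp only [pick, if_neg hi]
    exact (χ.agP_nonempty i ((r' t).loc i)).some_mem

/-! ### The causal cone avoiding a set of agents -/

/-- The nodes with a causal path to `θ` that avoids the agents in `B`. -/
def avoidCone (r : Run S) (B : Set S.Agent) (θ : Node S) : Set (Node S) :=
  {ζ | ∃ k ξ, IsCausalPath r k ξ ζ θ ∧ ∀ l ≤ k, (ξ l).1 ∉ B}

theorem notMem_of_mem_avoidCone {r : Run S} {B : Set S.Agent} {θ a : Node S}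
    (ha : a ∈ avoidCone r B θ) : a.1 ∉ B := by
  obtain ⟨k, ξ, ⟨rfl, -⟩, hB⟩ := ha
  exact hB 0 (Nat.zero_le k)

theorem mem_avoidCone_self {r : Run S} {B : Set S.Agent} {θ : Node S} (hθ : θ.1 ∉ B) :
    θ ∈ avoidCone r B θ :=
  ⟨0, fun _ => θ, ⟨rfl, rfl, by simp⟩, fun _ _ => hθ⟩

theorem mem_avoidCone_of_causalLink {r : Run S} {B : Set S.Agent} {θ a b : Node S}
    (hab : CausalLink r a b) (ha : a.1 ∉ B) (hb : b ∈ avoidCone r B θ) :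
    a ∈ avoidCone r B θ := by
  obtain ⟨k, ξ, ⟨rfl, rfl, hl⟩, hB⟩ := hb
  refine ⟨k + 1, fun n => Nat.casesOn n a ξ, ⟨rfl, rfl, ?_⟩, ?_⟩
  · rintro (_ | l) hlk
    · exact hab
    · exact hl l (by omega)
  · rintro (_ | l) hlk
    · exact ha
    · exact hB l (by omega)

/-- A faulty node of the cone would lie in the fault buffer, which would put its agent in `B`. -/
theorem nodeCorrect_of_mem_avoidCone {r : Run S} {B : Set S.Agent} {θ : Node S}
    (hB : byz r θ ⊆ B) {j : S.Agent} {m : ℕ} (hm : m < θ.2) (hj : (j, m) ∈ avoidCone r B θ) :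
    NodeCorrect r (j, m + 1) := by
  by_contra hc
  refine notMem_of_mem_avoidCone hj (hB ⟨m, hm, ?_, hc⟩)
  obtain ⟨k, ξ, hp, -⟩ := hj
  exact ⟨k, ξ, hp⟩

/-! ### The modified environment and its admissibility -/

/-- The events attempted in round `m` when the agents in `B` are replaced by byzantine agents that
send what they sent in `r`, and the other agents take part only at the nodes of the cone that avoids
`B`. -/
def vatEvents (r : Run S) (B : Set S.Agent) (θ : Node S) (X : Set (GEvent S)) (m : ℕ) :
    Set (GEvent S) :=
  {e | (∃ b A, b ∈ B ∧ A ∈ sent r m b ∧ e = .fakeAct b (some A) none) ∨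
    (m < θ.2 ∧ (e.agent, m) ∈ avoidCone r B θ ∧ e ∈ X ∧ ¬ e.IsFaulty)}

theorem mem_vatEvents_of_not_isFaulty {r : Run S} {B : Set S.Agent} {θ : Node S}
    {X : Set (GEvent S)} {m : ℕ} {e : GEvent S} (he : ¬ e.IsFaulty) :
    e ∈ vatEvents r B θ X m ↔ m < θ.2 ∧ (e.agent, m) ∈ avoidCone r B θ ∧ e ∈ X := by
  constructor
  · rintro (⟨b, A, -, -, rfl⟩ | h)
    · exact absurd trivial he
    · exact ⟨h.1, h.2.1, h.2.2.1⟩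
  · exact fun h => Or.inr ⟨h.1, h.2.1, h.2.2, he⟩

theorem agent_mem_of_mem_vatEvents {r : Run S} {B : Set S.Agent} {θ : Node S}
    {X : Set (GEvent S)} {m : ℕ} {e : GEvent S} (h : e ∈ vatEvents r B θ X m)
    (he : e.IsFaulty) : e.agent ∈ B := by
  obtain ⟨b, A, hb, -, rfl⟩ | h := h
  · exact hb
  · exact absurd he h.2.2.2

/-- Byzantine actions perceived as nothing add neither system events nor fake correct events, so
only the identifier clause needs an assumption. -/
theorem Coherent.union_fakeAct {t : ℕ} {X : Set (GEvent S)} (hX : Coherent t X) (b : S.Agent)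
    (Y : Set (GAction S b))
    (hY : ∀ A ∈ Y, ∀ j μ d, A.IsSend j μ d → ∃ k, d = S.gmi (b, j, μ, k, t)) :
    Coherent t ({e | ∃ A ∈ Y, e = .fakeAct b (some A) none} ∪ (X \ gEvents S b)) where
  system i := (hX.system i).anti <| by
    rintro e ⟨⟨A, -, rfl⟩ | he, hs⟩
    · simp at hs
    · exact ⟨he.1, hs⟩
  perception i E E' h h' := by
    simp only [Set.mem_union, Set.mem_ofPred_eq, reduceCtorEq, and_false, exists_false,
      false_or] at h h'
    exact hX.perception i E E' h.1 h'.1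
  identifier i A A' j μ d h hd := by
    rcases h with ⟨A₀, hA₀, he⟩ | h
    · cases he
      exact hY _ hA₀ j μ d hd
    · exact hX.identifier i A A' j μ d h.1 hd

/-- The agents are modified one at a time: gullibility serves those in `B`, correctability those in
the cone, and delayability all others. -/
theorem vatEvents_mem_envP {χ : AgentContext S} (hgull : ∀ j, Gullible χ j)
    (hcorr : ∀ j, Correctable χ j) (hdel : ∀ j, Delayable χ j) {r : Run S}
    {X : ℕ → Set (GEvent S)} {α : ℕ → (i : S.Agent) → Set (LAction S i)} (h : Executes χ r X α)
    (B : Set S.Agent) (θ : Node S) (m : ℕ) :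
    vatEvents r B θ (X m) m ∈ χ.envP m := by
  classical
  -- `F` is the set of agents already modified.
  suffices H : ∀ F : Finset S.Agent,
      {e | if e.agent ∈ F then e ∈ vatEvents r B θ (X m) m else e ∈ X m} ∈ χ.envP m by
    simpa using H Finset.univ
  intro F
  induction F using Finset.induction_on with
  | empty => simpa using h.env_mem m
  | insert b F hb ih =>
    by_cases hbB : b ∈ B
    · have hY := (χ.envP_coherent m _ ih).union_fakeAct b (sent r m b)
        fun A hA j μ d hd => h.identifier_of_mem_sent hA hd
      convert hgull b m _ ih _ _ hY using 1
      · ext e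
        by_cases he : e.agent = b
        · have hc : (e.agent, m) ∉ avoidCone r B θ := fun hc =>
            notMem_of_mem_avoidCone hc (he ▸ hbB)
          simp only [he, Finset.mem_insert_self, if_true, gEvents, Set.mem_union, Set.mem_sdiff,
            Set.mem_ofPred_eq, not_true_eq_false, and_false, or_false, vatEvents]
          rw [he] at hc
          simp only [hc, false_and, and_false, or_false]
          constructor
          · rintro ⟨b', A, -, hA, rfl⟩
            cases he
            exact ⟨A, hA, rfl⟩
          · rintro ⟨A, hA, rfl⟩
            exact ⟨b, A, hbB, hA, rfl⟩
        · simp only [Finset.mem_insert, he, false_or, gEvents, Set.mem_union, Set.mem_sdiff,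
            Set.mem_ofPred_eq, not_false_eq_true, and_true]
          refine (or_iff_right ?_).symm
          rintro ⟨A, -, rfl⟩
          exact he rfl
      · rintro e ⟨A, -, rfl⟩
        exact ⟨rfl, trivial⟩
    · have hv : ∀ e : GEvent S, e.agent = b → (e ∈ vatEvents r B θ (X m) m ↔
          m < θ.2 ∧ (b, m) ∈ avoidCone r B θ ∧ e ∈ X m ∧ ¬ e.IsFaulty) := by
        rintro e rfl
        refine or_iff_right ?_
        rintro ⟨b', A, hb', -, rfl⟩
        exact hbB hb'
      by_cases hc : m < θ.2 ∧ (b, m) ∈ avoidCone r B θ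
      -- The attempted set may contain faults of `b` that the first filter cancelled in `r`; they
      -- have to be removed here.
      · convert hcorr b m _ ih using 1
        ext e
        by_cases he : e.agent = b
        · simp [he, hv e he, hb, hc, fEvents]
        · simp [he, fEvents]
      · convert hdel b m _ ih using 1
        ext e
        by_cases he : e.agent = b
        · have : e ∉ vatEvents r B θ (X m) m := fun h' => hc ⟨((hv e he).1 h').1, ((hv e he).1 h').2.1⟩
          simp [he, this, gEvents]
        · simp [he, gEvents]

/-! ### Comparison of the two runs -/

section Vat

variable {χ : AgentContext S} {r r' : Run S} {X : ℕ → Set (GEvent S)}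
  {α α' : ℕ → (i : S.Agent) → Set (LAction S i)} {B : Set S.Agent} {θ : Node S}

theorem vat_failed_subset (h' : Executes χ r' (fun m => vatEvents r B θ (X m) m) α') (m : ℕ) :
    {j | (r' m).Failed j} ⊆ B := by
  intro j hj
  obtain ⟨s, -, e, he, rfl, hf⟩ := h'.failed_iff.1 hj
  exact agent_mem_of_mem_vatEvents (h'.betaEnv_subset s he) hf

/-- Past and present faults all belong to agents in `B`, so the bound `f` is never exceeded. -/
theorem vat_filterLe (h' : Executes χ r' (fun m => vatEvents r B θ (X m) m) α')
    (hf : B.ncard ≤ χ.f) (m : ℕ) :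
    filterLe χ.f (r' m) (vatEvents r B θ (X m) m) = vatEvents r B θ (X m) m := by
  refine if_pos ((Set.ncard_le_ncard (Set.union_subset (vat_failed_subset h' m) ?_)).trans hf)
  rintro j ⟨e, he, rfl, hf⟩
  exact agent_mem_of_mem_vatEvents he hf

/-- Agents in `B` get no `go` in the new run, so their only actions are the replayed ones. -/
theorem vat_sent_iff_of_mem (h' : Executes χ r' (fun m => vatEvents r B θ (X m) m) α')
    (hf : B.ncard ≤ χ.f) {b : S.Agent} (hb : b ∈ B) {m : ℕ} {A : GAction S b} :
    A ∈ sent r' m b ↔ A ∈ sent r m b := by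
  constructor
  · rintro (hA | ⟨A', hA⟩)
    · have := h'.go_mem_betaEnv.1 (h'.mem_betaAg.1 hA).2
      rw [mem_vatEvents_of_not_isFaulty (by simp [GEvent.IsFaulty])] at this
      exact absurd hb (notMem_of_mem_avoidCone this.2.1)
    · obtain ⟨b', A₀, -, hA₀, he⟩ | hA := h'.betaEnv_subset m hA
      · cases he
        exact hA₀
      · exact absurd trivial hA.2.2.2
  · intro hA
    refine Or.inr ⟨none, ?_⟩
    rw [h'.mem_betaEnv_of_forall_ne (by simp), vat_filterLe h' hf]
    exact Or.inl ⟨b, A, hb, hA, rfl⟩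

/-- Equal local states give equal protocol choices, `go` is kept at cone nodes, and neither run has
byzantine actions there. -/
theorem vat_sent_iff_of_mem_avoidCone (h : Executes χ r X α)
    (h' : Executes χ r' (fun m => vatEvents r B θ (X m) m) α')
    (hα : ∀ t i, (r' t).loc i = (r t).loc i → α' t i = α t i) (hB : byz r θ ⊆ B)
    {j : S.Agent} {m : ℕ} (hm : m < θ.2) (hj : (j, m) ∈ avoidCone r B θ)
    (hloc : (r' m).loc j = (r m).loc j) {A : GAction S j} :
    (A ∈ betaAg r' m j ↔ A ∈ betaAg r m j) ∧ (A ∈ sent r' m j ↔ A ∈ sent r m j) := by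
  have hag : A ∈ betaAg r' m j ↔ A ∈ betaAg r m j := by
    rw [h.mem_betaAg, h'.mem_betaAg, hα m j hloc, h.go_mem_betaEnv, h'.go_mem_betaEnv,
      mem_vatEvents_of_not_isFaulty (by simp [GEvent.IsFaulty])]
    simp [hm, hj, GEvent.agent]
  refine ⟨hag, or_congr hag (iff_of_false ?_ ?_)⟩
  · rintro ⟨A', hA⟩
    exact notMem_of_mem_avoidCone hj
      (agent_mem_of_mem_vatEvents (h'.betaEnv_subset m hA) trivial)
  · rintro ⟨A', hA⟩
    exact nodeCorrect_of_mem_avoidCone hB hm hj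
      (h.failed_iff.2 ⟨m, Nat.lt_succ_self m, _, hA, rfl, trivial⟩)

/-- Nothing new is ever sent: an agent outside `B` acts only at cone nodes. The converse can fail,
since agents are silenced off the cone. -/
theorem sent_of_vat_sent (h : Executes χ r X α)
    (h' : Executes χ r' (fun m => vatEvents r B θ (X m) m) α')
    (hα : ∀ t i, (r' t).loc i = (r t).loc i → α' t i = α t i) (hB : byz r θ ⊆ B)
    (hf : B.ncard ≤ χ.f) {j : S.Agent} {m : ℕ}
    (hloc : m < θ.2 → (j, m) ∈ avoidCone r B θ → (r' m).loc j = (r m).loc j)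
    {A : GAction S j} (hA : A ∈ sent r' m j) : A ∈ sent r m j := by
  by_cases hj : j ∈ B
  · exact (vat_sent_iff_of_mem h' hf hj).1 hA
  · have : m < θ.2 ∧ (j, m) ∈ avoidCone r B θ := by
      rcases hA with hA | ⟨A', hA⟩
      · have := h'.go_mem_betaEnv.1 (h'.mem_betaAg.1 hA).2
        rw [mem_vatEvents_of_not_isFaulty (by simp [GEvent.IsFaulty])] at this
        exact ⟨this.1, this.2.1⟩
      · exact absurd (agent_mem_of_mem_vatEvents (h'.betaEnv_subset m hA) trivial) hj
    exact (vat_sent_iff_of_mem_avoidCone h h' hα hB this.1 this.2 (hloc this.1 this.2)).2.1 hA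

/-- Correct events of the modified run happen at the same nodes in `r`, inside the cone. -/
theorem correct_mem_of_vat (h : Executes χ r X α)
    (h' : Executes χ r' (fun m => vatEvents r B θ (X m) m) α')
    (hα : ∀ t i, (r' t).loc i = (r t).loc i → α' t i = α t i) (hB : byz r θ ⊆ B)
    (hf : B.ncard ≤ χ.f) {m : ℕ}
    (hloc : ∀ s ≤ m, ∀ j, s < θ.2 → (j, s) ∈ avoidCone r B θ → (r' s).loc j = (r s).loc j)
    {j : S.Agent} {E : CEvent S j} (hE : .correct j E ∈ betaEnv r' m) :
    m < θ.2 ∧ (j, m) ∈ avoidCone r B θ ∧ .correct j E ∈ betaEnv r m := by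
  obtain ⟨hX, hS⟩ := h'.correct_mem_betaEnv.1 hE
  rw [mem_vatEvents_of_not_isFaulty (by simp [GEvent.IsFaulty])] at hX
  refine ⟨hX.1, hX.2.1, h.correct_mem_betaEnv.2 ⟨hX.2.2, fun i μ d he => ?_⟩⟩
  obtain ⟨A, hd, s, hs, hA⟩ := hS i μ d he
  exact ⟨A, hd, s, hs, sent_of_vat_sent h h' hα hB hf (hloc s hs i) hA⟩

/-- Agents cannot tell the two runs apart at the nodes of the cone that avoids `B`. -/
theorem vat_loc_eq (h : Executes χ r X α)
    (h' : Executes χ r' (fun m => vatEvents r B θ (X m) m) α') (h0 : r' 0 = r 0)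
    (hα : ∀ t i, (r' t).loc i = (r t).loc i → α' t i = α t i) (hB : byz r θ ⊆ B)
    (hf : B.ncard ≤ χ.f) {m : ℕ} (hm : m ≤ θ.2) {j : S.Agent}
    (hj : (j, m) ∈ avoidCone r B θ) : (r' m).loc j = (r m).loc j := by
  induction m using Nat.strong_induction_on generalizing j with
  | _ m ih =>
  cases m with
  | zero => rw [h0]
  | succ m =>
    have hjm : (j, m) ∈ avoidCone r B θ :=
      mem_avoidCone_of_causalLink (Or.inl rfl) (notMem_of_mem_avoidCone (a := (j, m + 1)) hj) hj
    have hlt : m < θ.2 := hm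
    have hloc := ih m m.lt_succ_self hlt.le hjm
    have hcorrect := nodeCorrect_of_mem_avoidCone hB hlt hjm
    have hev : ∀ e : GEvent S, e.agent = j → (e ∈ betaEnv r' m ↔ e ∈ betaEnv r m) := by
      rintro e rfl
      by_cases he : e.IsFaulty
      · refine iff_of_false (fun hm' => ?_) fun hm' => ?_
        · exact notMem_of_mem_avoidCone hjm
            (agent_mem_of_mem_vatEvents (h'.betaEnv_subset m hm') he)
        · exact hcorrect (h.failed_iff.2 ⟨m, m.lt_succ_self, e, hm', rfl, he⟩)
      · cases e with
        | correct j E =>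
          refine ⟨fun hE => (correct_mem_of_vat h h' hα hB hf (fun s hs k hk hc =>
            ih s (Nat.lt_succ_of_le hs) hk.le hc) hE).2.2, fun hE => ?_⟩
          obtain ⟨hX, hS⟩ := h.correct_mem_betaEnv.1 hE
          refine h'.correct_mem_betaEnv.2
            ⟨(mem_vatEvents_of_not_isFaulty he).2 ⟨hlt, hjm, hX⟩, ?_⟩
          rintro i μ d rfl
          obtain ⟨A, hd, s, hs, hA⟩ := hS i μ d rfl
          refine ⟨A, hd, s, hs, ?_⟩
          -- A sender outside `B` is joined to `(j, m + 1)` by a message link, so its node lies in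
          -- the cone. Its time `s` may be any time up to `m`, hence the strong induction.
          by_cases hi : i ∈ B
          · exact (vat_sent_iff_of_mem h' hf hi).2 hA
          · have hc : (i, s) ∈ avoidCone r B θ :=
              mem_avoidCone_of_causalLink (Or.inr ⟨m, rfl, μ, d, hE, A, hd, hA⟩) hi hj
            exact (vat_sent_iff_of_mem_avoidCone h h' hα hB (by omega) hc
              (ih s (Nat.lt_succ_of_le hs) (by omega) hc)).2.2 hA
        | go j =>
          rw [h.go_mem_betaEnv, h'.go_mem_betaEnv, mem_vatEvents_of_not_isFaulty he]
          simp only [hlt, hjm, true_and]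
        | fakeEv j E => exact absurd trivial he
        | fakeAct j A A' => exact absurd trivial he
        | sleep j => exact absurd trivial he
        | hibernate j => exact absurd trivial he
    have hag : filterAg (betaEnv r' m) (fun i => label m (α' m i)) j =
        filterAg (betaEnv r m) (fun i => label m (α m i)) j := by
      ext A
      simp only [filterAg, Set.mem_ofPred_eq, hev (.go j) rfl, hα m j hloc]
    rw [h.step, h'.step, ← h.betaEnv_eq, ← h'.betaEnv_eq]
    simp only [update]
    rw [hag, hloc, updateAg_congr _ _ hev]

end Vat

end ByzCausal

/-! ### The main theorem -/

theorem theorem3 (S : ByzCausal.Signature) (χ : ByzCausal.AgentContext S)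
    (hne : ByzCausal.NonExcluding χ)
    (hgull : ∀ j, ByzCausal.Gullible χ j)
    (hcorr : ∀ j, ByzCausal.Correctable χ j)
    (hdel : ∀ j, ByzCausal.Delayable χ j)
    {Atom : Type*} (π : Atom → Set (ByzCausal.runs χ × ℕ))
    (r : ByzCausal.runs χ) (i : S.Agent) (t : ℕ)
    (hθ : ByzCausal.NodeCorrect r.1 (i, t))
    (o : S.LEvent) (ho : o ∈ S.events)
    (hope : ByzCausal.Sat χ π (ByzCausal.Formula.hope i (.trueOcc o)) r t ∨
      ByzCausal.ContainsMultipede χ r.1 o (i, t))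
    (T : Set S.Agent)
    (hT : T ⊆ Set.univ \ ({i} ∪ ByzCausal.byz r.1 (i, t)))
    (hcard : (T.ncard : ℤ) = (χ.f : ℤ) - ((ByzCausal.byz r.1 (i, t)).ncard : ℤ)) :
    ∃ (w : S.Agent) (m : ℕ), ByzCausal.CorrectlyOccursAt r.1 o w m ∧
      ∃ (k : ℕ) (ξ : ℕ → ByzCausal.Node S),
        ByzCausal.IsCausalPath r.1 k ξ (w, m) (i, t) ∧
          ∀ l ≤ k, (ξ l).1 ∉ T ∪ ByzCausal.byz r.1 (i, t) := by
  open ByzCausal in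
  obtain ⟨X, α, h⟩ := r.2.1.exists_executes
  set B : Set S.Agent := T ∪ byz r.1 (i, t) with hBdef
  have hB : byz r.1 (i, t) ⊆ B := Set.subset_union_right
  have hf : B.ncard ≤ χ.f := by
    have := Set.ncard_union_le T (byz r.1 (i, t))
    rw [← hBdef] at this
    omega
  have hiB : i ∉ B := by
    rintro (hi | ⟨m, hm, -, hc⟩)
    · exact (hT hi).2 (Or.inl rfl)
    -- Faults persist in the history: a fault of `i` by time `m + 1 ≤ t` would make `(i, t)` faulty.
    · refine hc fun hF => hθ ?_
      obtain ⟨s, hs, he⟩ := h.failed_iff.1 hF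
      exact h.failed_iff.2 ⟨s, lt_of_lt_of_le hs hm, he⟩
  obtain ⟨r₁, α₁, h₁, h0, hα⟩ := exists_executes_of_env h fun m =>
    vatEvents_mem_envP hgull hcorr hdel h B (i, t) m
  -- The new run need not be admissible, so a prefix of it is extended. The prefix reaches `t + 1`
  -- because the multipede only places the event at some `m ≤ t`, and round `t` is recorded in the
  -- state at `t + 1`.
  obtain ⟨r₂, hr₂, hpre⟩ := hne r₁ h₁.weaklyConsistent (t + 1)
  have hloc : ∀ s ≤ t, ∀ j, (j, s) ∈ avoidCone r.1 B (i, t) → (r₁ s).loc j = (r.1 s).loc j :=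
    fun s hs j hj => vat_loc_eq h h₁ h0 hα hB hf hs hj
  have hsame : (r.1 t).loc i = (r₂ t).loc i := by
    rw [hpre t t.le_succ]
    exact (hloc t le_rfl i (mem_avoidCone_self hiB)).symm
  have hcor₂ : NodeCorrect r₂ (i, t) := by
    rw [NodeCorrect, hpre t t.le_succ]
    exact fun hF => hiB (vat_failed_subset h₁ t hF)
  suffices H : ∃ j m, m ≤ t ∧ CorrectlyOccursAt r₂ o j m by
    obtain ⟨j, m, hm, E, hE, hEo⟩ := H
    rw [betaEnv, hpre (m + 1) (by omega)] at hE
    obtain ⟨-, hc, hE'⟩ := correct_mem_of_vat h h₁ hα hB hf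
      (fun s _ j hst hj => hloc s (le_of_lt hst) j hj) hE
    exact ⟨j, m, ⟨E, hE', hEo⟩, hc⟩
  rcases hope with hope | hmulti
  · simp only [Formula.hope, Formula.imp, Sat, not_and, not_not] at hope
    obtain ⟨j, m, -, hm, hO⟩ := hope hθ ⟨r₂, hr₂⟩ t hsame hcor₂
    exact ⟨j, m - 1, by omega, hO⟩
  -- Of the path in the cone only the bound `m ≤ t` is needed, as causal paths run forward in time;
  -- reliability plays no role.
  · obtain ⟨j, m, ⟨k, ξ, hp, -⟩, hO⟩ := hmulti r₂ hr₂ hsame hcor₂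
    obtain ⟨X₂, α₂, h₂⟩ := hr₂.1.exists_executes
    exact ⟨j, m, h₂.le_of_isCausalPath hp, hO⟩
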